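/- For a finite alphabet $\Sigma$ let $\bar\Sigma=\{\bar a : a\in\Sigma\}$ be a disjoint marked copy of $\Sigma$, and for a word $w=a_1a_2\cdots a_n\in\Sigma^*$ let $\overline{w}=\bar a_1\bar a_2\cdots\bar a_n$. A deterministic linear context-free language is a language accepted, by final state, by a deterministic pushdown automaton that makes at most one reversal on its stack, i.e. in each of its computations no step that decreases the height of the stack is followed later by a step that increases it ($\varepsilon$-moves are allowed). **Theorem.** It is undecidable for deterministic linear context-free languages $L\subseteq(\Sigma\cup\bar\Sigma)^*$ whether $w\overline{w}\in L$ for some word $w\in\Sigma^*$. That is, there is no algorithm which, given (the transition table of) a deterministic pushdown automaton making at most one reversal, with input alphabet $\Sigma\cup\bar\Sigma$ for a finite alphabet $\Sigma$ that is part of the input, always halts and decides whether the accepted language contains a word $w\overline{w}$ with $w\in\Sigma^*$. -/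

import Mathlib

/-- A transition of a pushdown automaton with input letters `T`, states `Q` and stack symbols `S`:
in state `source`, with `pop` on top of the stack, read `read` (`none` means that no input letter
is consumed), go to state `target` and replace the top `pop` by the word `push`, whose first
symbol is the new top. -/
structure PDATransition (T Q S : Type*) where
  source : Q
  read : Option T
  pop : S
  target : Q
  push : List S

/-- A pushdown automaton. It has finitely many transitions and accepting states; the finite
alphabets and the finite state set are those of the symbols that occur in it. -/
structure PDA (T Q S : Type*) where
  start : Q
  bottom : S
  accept : List Q
  transitions : List (PDATransition T Q S)

/-- A configuration: current state, input that is still to be read, stack (top first). -/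
structure PDAConfig (T Q S : Type*) where
  state : Q
  input : List T
  stack : List S

namespace PDA

variable {T Q S : Type*}

/-- The initial configuration on input `w`; the stack holds the bottom symbol only. -/
def init (M : PDA T Q S) (w : List T) : PDAConfig T Q S :=
  ⟨M.start, w, [M.bottom]⟩

/-- One step of the automaton. -/
def Step (M : PDA T Q S) (c d : PDAConfig T Q S) : Prop :=
  ∃ t ∈ M.transitions, ∃ (w : List T) (s : List S),
    c = ⟨t.source, t.read.toList ++ w, t.pop :: s⟩ ∧ d = ⟨t.target, w, t.push ++ s⟩

/-- Finitely many (possibly zero) steps. -/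
def Reaches (M : PDA T Q S) : PDAConfig T Q S → PDAConfig T Q S → Prop :=
  Relation.ReflTransGen M.Step

/-- The accepted language: acceptance by final state after the whole input has been read. -/
def language (M : PDA T Q S) : Language T :=
  {w | ∃ q ∈ M.accept, ∃ s : List S, M.Reaches (M.init w) ⟨q, [], s⟩}

/-- Two transitions that can be enabled in the same configuration are equal. -/
def IsDeterministic (M : PDA T Q S) : Prop :=
  ∀ t ∈ M.transitions, ∀ t' ∈ M.transitions, t.source = t'.source → t.pop = t'.pop →
    (t.read = t'.read ∨ t.read = none ∨ t'.read = none) → t = t'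

/-- The automaton makes at most one reversal on its stack: in every computation, on every input,
a step that decreases the height of the stack is never followed, immediately or later, by a step
that increases it. -/
def IsLinear (M : PDA T Q S) : Prop :=
  ∀ (w : List T) (a b c d : PDAConfig T Q S), M.Reaches (M.init w) a → M.Step a b →
    M.Reaches b c → M.Step c d → b.stack.length < a.stack.length →
    d.stack.length ≤ c.stack.length

end PDA

/-- Transitions as tuples. -/
def PDATransition.equivProd (T Q S : Type*) :
    PDATransition T Q S ≃ Q × Option T × S × Q × List S where
  toFun t := (t.source, t.read, t.pop, t.target, t.push)
  invFun p := ⟨p.1, p.2.1, p.2.2.1, p.2.2.2.1, p.2.2.2.2⟩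
  left_inv _ := rfl
  right_inv _ := rfl

instance PDATransition.instPrimcodable {T Q S : Type*} [Primcodable T] [Primcodable Q]
    [Primcodable S] : Primcodable (PDATransition T Q S) :=
  Primcodable.ofEquiv _ (PDATransition.equivProd T Q S)

/-- Pushdown automata as tuples. -/
def PDA.equivProd (T Q S : Type*) :
    PDA T Q S ≃ Q × S × List Q × List (PDATransition T Q S) where
  toFun M := (M.start, M.bottom, M.accept, M.transitions)
  invFun p := ⟨p.1, p.2.1, p.2.2.1, p.2.2.2⟩
  left_inv _ := rfl
  right_inv _ := rfl

/-- Pushdown automata as inputs of algorithms, through the standard coding of tuples and lists. -/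
instance PDA.instPrimcodable {T Q S : Type*} [Primcodable T] [Primcodable Q]
    [Primcodable S] : Primcodable (PDA T Q S) :=
  Primcodable.ofEquiv _ (PDA.equivProd T Q S)

/-- The letters of `Σ ∪ Σ̄`, where `Σ` is a set of natural numbers: `Sum.inl a` is the letter `a`
itself and `Sum.inr a` is its marked copy. -/
abbrev MarkedLetter : Type := ℕ ⊕ ℕ

/-- The word `w`, seen as a word over `Σ ∪ Σ̄`. -/
def unmarkedWord (w : List ℕ) : List MarkedLetter := w.map Sum.inl

/-- The marked copy of the word `w`. -/
def markedCopy (w : List ℕ) : List MarkedLetter := w.map Sum.inr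

/-- Property `p` is decidable for the members of the class `C`: some algorithm halts on every member
`a` of `C` and answers whether `p a` holds. Nothing is asked of it outside `C`. -/
def DecidableOn {α : Type*} [Primcodable α] (C : Set α) (p : α → Prop) : Prop :=
  ∃ f : α →. Bool, Partrec f ∧ ∀ a ∈ C, ∃ b ∈ f a, (b = true ↔ p a)

/-! The halting problem of one fixed Turing machine is reduced to the question about copies. A queue
machine simulates the Turing machine: its queue holds the tape as a cyclic word, with a mark where
the two ends meet, and is rotated letter by letter. A left move changes the letter that precedes the
head before the head itself is seen, so the queue machine guesses it and checks the guess at the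
next letter. Halting then means that some path `l` of edges has reads that spell `s` followed by the
writes of `l`, where `s` is the initial queue (`TapeQueue.accepts_iff`).

On the word `l $ y` the automaton checks that `l` is a path and pushes `s`, the writes of `l`, a
separator and `y`. On the marked word it pops the reads of its edges against the reversal of `y`,
then its second part against the reversal of `s` and the writes. Since the marked word is a copy,
both halves carry the same `l` and `y`, and the two comparisons combine to: reads of `l` = reversal
of `y` = `s` followed by the writes of `l` (`CopyAutomaton.exists_mem_language_iff`). Neither
comparison alone could be combined with the other without the copy. Nothing is pushed after the
first pop, and the letters of `l` name the edges, so guesses of the queue machine cost no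
determinism.

The Turing machine is fixed, so only the word pushed at the start depends on the instance, and the
reduction is computable. -/

/-! ### Queue machines and their paths -/

/-- A transition of a queue machine: in state `source`, remove the letter `read` from the front of
the queue, append the word `write` at its back, and go to state `target`. -/
structure QueueEdge (Q A : Type*) where
  source : Q
  read : A
  write : List A
  target : Q

namespace QueueEdge

variable {Q A : Type*}

/-- `IsPath E p l q`: the edges `l`, all from `E`, form a path from `p` to `q`. -/
inductive IsPath (E : List (QueueEdge Q A)) : Q → List (QueueEdge Q A) → Q → Prop
  | nil (q : Q) : IsPath E q [] q
  | cons {e : QueueEdge Q A} {l : List (QueueEdge Q A)} {q : Q} :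
      e ∈ E → IsPath E e.target l q → IsPath E e.source (e :: l) q

theorem IsPath.snoc {E : List (QueueEdge Q A)} {p q : Q} {l : List (QueueEdge Q A)}
    (h : IsPath E p l q) {e : QueueEdge Q A} (he : e ∈ E) (hq : e.source = q) :
    IsPath E p (l ++ [e]) e.target := by
  induction h with
  | nil q => subst hq; exact .cons he (.nil _)
  | cons h' _ ih => exact .cons h' (ih hq)

/-- Some path from `p` to `q` reads exactly the word `s` followed by what the path itself writes. A
run of the queue machine from state `p` and queue `s` to state `q` and the empty queue is such a
path; conversely, such a path is a run unless the queue becomes empty before its end. -/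
def Accepts (E : List (QueueEdge Q A)) (p : Q) (s : List A) (q : Q) : Prop :=
  ∃ l, IsPath E p l q ∧ l.map read = s ++ l.flatMap write

theorem Accepts.nil (E : List (QueueEdge Q A)) (q : Q) : Accepts E q [] q :=
  ⟨[], .nil q, rfl⟩

theorem Accepts.cons {E : List (QueueEdge Q A)} {e : QueueEdge Q A} (he : e ∈ E) {s : List A}
    {q : Q} (h : Accepts E e.target (s ++ e.write) q) : Accepts E e.source (e.read :: s) q := by
  obtain ⟨l, hl, h⟩ := h
  exact ⟨e :: l, .cons he hl, by simp [h]⟩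

end QueueEdge

/-! ### Simulation of a Turing machine by a queue machine -/

namespace TapeQueue

open Turing

/-- Queue letters: a tape symbol, the tape symbol under the head, or the mark that separates the
right end of the tape from its left end. -/
inductive Letter (Γ : Type)
  | plain : Γ → Letter Γ
  | head : Γ → Letter Γ
  | sep : Letter Γ

/-- States of the queue machine that simulates a Turing machine with states `Λ`. -/
inductive State (Λ : Type)
  | scan : Λ → State Λ
  | mark : Λ → State Λ
  | left : Λ → State Λ
  | halt : State Λ

open Letter State

variable {Γ Λ : Type}

theorem letter_injective : Function.Injective
    (fun x : Letter Γ => match x with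
      | plain a => (Sum.inl a : Γ ⊕ Γ ⊕ Unit)
      | head a => Sum.inr (Sum.inl a)
      | sep => Sum.inr (Sum.inr ())) := by
  rintro (a | a | _) (b | b | _) <;> simp

theorem state_injective : Function.Injective
    (fun x : State Λ => match x with
      | scan q => (Sum.inl q : Λ ⊕ Λ ⊕ Λ ⊕ Unit)
      | mark q => Sum.inr (Sum.inl q)
      | left q => Sum.inr (Sum.inr (Sum.inl q))
      | halt => Sum.inr (Sum.inr (Sum.inr ()))) := by
  rintro (a | a | a | _) (b | b | b | _) <;> simp

instance [Finite Γ] : Finite (Letter Γ) := Finite.of_injective _ letter_injective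

instance [Finite Λ] : Finite (State Λ) := Finite.of_injective _ state_injective

variable [Inhabited Γ] [Inhabited Λ]

/-- The transitions for a Turing machine transition in state `q` with `a` under the head. -/
def actEdges (q : Λ) (a : Γ) : Option (Λ × TM0.Stmt Γ) → List (QueueEdge (State Λ) (Letter Γ))
  | none => [⟨scan q, head a, [], halt⟩]
  | some (q', .write b) => [⟨scan q, head a, [head b], scan q'⟩]
  | some (q', .move .right) => [⟨scan q, head a, [plain a], mark q'⟩]
  | some (q', .move .left) => [⟨left q, head a, [plain a], scan q'⟩]

/-- The transitions that do not depend on the machine. -/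
def moveEdges (q : Λ) (a : Γ) : List (QueueEdge (State Λ) (Letter Γ)) :=
  [⟨scan q, plain a, [plain a], scan q⟩,
    ⟨mark q, plain a, [head a], scan q⟩,
    ⟨scan q, plain a, [head a], left q⟩,
    ⟨halt, plain a, [], halt⟩,
    ⟨scan q, sep, [sep], scan q⟩,
    ⟨mark q, sep, [head default, sep], scan q⟩,
    ⟨scan q, sep, [sep, head default], left q⟩,
    ⟨halt, sep, [], halt⟩]

/-- The queue machine that simulates the Turing machine `M`. -/
noncomputable def edges [Fintype Λ] [Fintype Γ] (M : TM0.Machine Γ Λ) :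
    List (QueueEdge (State Λ) (Letter Γ)) :=
  (Finset.univ : Finset (Λ × Γ)).toList.flatMap
    fun x => actEdges x.1 x.2 (M x.1 x.2) ++ moveEdges x.1 x.2

theorem mem_edges [Fintype Λ] [Fintype Γ] {M : TM0.Machine Γ Λ}
    {e : QueueEdge (State Λ) (Letter Γ)} :
    e ∈ edges M ↔ ∃ q a, e ∈ actEdges q a (M q a) ∨ e ∈ moveEdges q a := by
  simp [edges]

/-- The tape content, read cyclically from the cell to the right of the head. -/
def ring (L R : List Γ) : List (Letter Γ) :=
  R.map plain ++ sep :: L.reverse.map plain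

omit [Inhabited Γ] in
theorem head_notMem_ring (L R : List Γ) (a : Γ) : head a ∉ ring L R := by
  simp [ring]

omit [Inhabited Γ] in
theorem ring_ne_nil (L R : List Γ) : ring L R ≠ [] := by
  simp [ring]

/-! ### Soundness: an accepting path forces the Turing machine to halt -/

/-- The machine halts when started in the configuration `c`. -/
def Halts (M : TM0.Machine Γ Λ) (c : TM0.Cfg Γ Λ) : Prop :=
  (StateTransition.eval (TM0.step M) c).Dom

theorem halts_of_step_none {M : TM0.Machine Γ Λ} {c : TM0.Cfg Γ Λ} (h : TM0.step M c = none) :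
    Halts M c :=
  Part.dom_iff_mem.2 ⟨c, StateTransition.mem_eval.2 ⟨.refl, h⟩⟩

theorem halts_of_step_some {M : TM0.Machine Γ Λ} {c d : TM0.Cfg Γ Λ} (h : TM0.step M c = some d)
    (hd : Halts M d) : Halts M c := by
  obtain ⟨b, hb⟩ := Part.dom_iff_mem.1 hd
  obtain ⟨h1, h2⟩ := StateTransition.mem_eval.1 hb
  exact Part.dom_iff_mem.2 ⟨b, StateTransition.mem_eval.2 ⟨.head h h1, h2⟩⟩

/-- The configuration in state `q` with `a` under the head. -/
def cfg (q : Λ) (L : List Γ) (a : Γ) (R : List Γ) : TM0.Cfg Γ Λ :=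
  ⟨q, ⟨a, ListBlank.mk L, ListBlank.mk R⟩⟩

/-- In state `scan q` the queue is a rotation of the tape. -/
def ScanRep (q : Λ) (s : List (Letter Γ)) (c : TM0.Cfg Γ Λ) : Prop :=
  ∃ L a R u w, s = u ++ head a :: w ∧ w ++ u = ring L R ∧ c = cfg q L a R

/-- The state and the queue of the queue machine are consistent with the halting of `M`. -/
def Sound (M : TM0.Machine Γ Λ) : State Λ → List (Letter Γ) → Prop
  | scan q, s => ∀ c, ScanRep q s c → Halts M c
  | mark q, s => ∀ L R, s = ring L R → Halts M (cfg q L R.headI R.tail)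
  | left q, s => ∀ s', (∀ c a, s = s' ++ [head a] → ScanRep q (plain a :: s') c → Halts M c) ∧
      (∀ c, s = s' ++ [sep, head default] → ScanRep q (sep :: s') c → Halts M c)
  | halt, _ => True

theorem step_cfg_none {M : TM0.Machine Γ Λ} {q : Λ} {a : Γ} (h : M q a = none) (L R : List Γ) :
    TM0.step M (cfg q L a R) = none := by
  simp [TM0.step, cfg, h]

theorem step_cfg_write {M : TM0.Machine Γ Λ} {q q' : Λ} {a b : Γ}
    (h : M q a = some (q', .write b)) (L R : List Γ) :
    TM0.step M (cfg q L a R) = some (cfg q' L b R) := by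
  simp [TM0.step, cfg, h, Tape.write]

theorem step_cfg_right {M : TM0.Machine Γ Λ} {q q' : Λ} {a : Γ}
    (h : M q a = some (q', .move .right)) (L R : List Γ) :
    TM0.step M (cfg q L a R) = some (cfg q' (a :: L) R.headI R.tail) := by
  simp [TM0.step, cfg, h, Tape.move]

theorem step_cfg_left {M : TM0.Machine Γ Λ} {q q' : Λ} {a : Γ}
    (h : M q a = some (q', .move .left)) (L R : List Γ) :
    TM0.step M (cfg q L a R) = some (cfg q' L.tail L.headI (a :: R)) := by
  simp [TM0.step, cfg, h, Tape.move]

omit [Inhabited Λ] in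
/-- When the head cell is at the front, the queue is determined by the tape. -/
theorem ScanRep.of_head {q : Λ} {a : Γ} {s : List (Letter Γ)} {c : TM0.Cfg Γ Λ}
    (h : ScanRep q (head a :: s) c) : ∃ L R, s = ring L R ∧ c = cfg q L a R := by
  obtain ⟨L, b, R, u, w, h1, h2, h3⟩ := h
  cases u with
  | nil =>
    simp only [List.nil_append, List.cons.injEq, head.injEq] at h1
    exact ⟨L, R, by rw [h1.2, ← h2, List.append_nil], by rw [h3, h1.1]⟩
  | cons x u =>
    simp only [List.cons_append, List.cons.injEq] at h1
    exact absurd (h2 ▸ by simp [← h1.1]) (head_notMem_ring L R a)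

omit [Inhabited Λ] in
theorem ScanRep.rotate {q : Λ} {x : Letter Γ} {s : List (Letter Γ)} {c : TM0.Cfg Γ Λ}
    (hx : ∀ a, x ≠ head a) (h : ScanRep q (x :: s) c) : ScanRep q (s ++ [x]) c := by
  obtain ⟨L, b, R, u, w, h1, h2, h3⟩ := h
  cases u with
  | nil =>
    simp only [List.nil_append, List.cons.injEq] at h1
    exact absurd h1.1 (hx b)
  | cons y u =>
    simp only [List.cons_append, List.cons.injEq] at h1
    exact ⟨L, b, R, u, w ++ [x], by simp [h1.2], by simp [← h2, h1.1], h3⟩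

omit [Inhabited Λ] in
/-- When the head cell is preceded by the letter at the front, that letter is the last one of the
ring. -/
theorem ScanRep.of_cons_head {q : Λ} {x : Letter Γ} {a : Γ} {s : List (Letter Γ)}
    {c : TM0.Cfg Γ Λ} (hx : ∀ a, x ≠ head a) (h : ScanRep q (x :: head a :: s) c) :
    ∃ L R, s ++ [x] = ring L R ∧ c = cfg q L a R := by
  have h := h.rotate hx
  rw [List.cons_append] at h
  exact h.of_head

omit [Inhabited Γ] in
theorem append_plain_eq_ring {s : List (Letter Γ)} {b : Γ} {L R : List Γ}
    (h : s ++ [plain b] = ring L R) : ∃ L', L = b :: L' ∧ s = ring L' R := by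
  cases L with
  | nil =>
    have := congrArg List.getLast? h
    simp [ring] at this
  | cons b' L =>
    have h' : s ++ [plain b] = ring L R ++ [plain b'] := by simp [h, ring]
    obtain ⟨h1, h2⟩ := List.append_inj' h' rfl
    simp only [List.cons.injEq, plain.injEq, and_true] at h2
    exact ⟨L, by rw [h2], h1⟩

omit [Inhabited Γ] in
theorem append_sep_eq_ring {s : List (Letter Γ)} {L R : List Γ}
    (h : s ++ [sep] = ring L R) : L = [] ∧ s = R.map plain := by
  cases L with
  | nil =>
    refine ⟨rfl, ?_⟩
    have h' : s ++ [sep] = R.map plain ++ [sep] := by simp [h, ring]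
    exact (List.append_inj' h' rfl).1
  | cons b' L =>
    have h' : s ++ [sep] = ring L R ++ [plain b'] := by simp [h, ring]
    simpa using (List.append_inj' h' rfl).2

/-- `Sound` is carried backwards along an edge: if the old queue represents a configuration, the new
queue represents its successor, whose halting is known. For a left move, `Sound` at `left q`
remembers the letter consumed by the guess, so the represented tape is the one before the guess. -/
theorem sound_act {M : TM0.Machine Γ Λ} {q : Λ} {a : Γ}
    {e : QueueEdge (State Λ) (Letter Γ)} (he : e ∈ actEdges q a (M q a)) {s : List (Letter Γ)}
    (h : Sound M e.target (s ++ e.write)) : Sound M e.source (e.read :: s) := by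
  rcases hM : M q a with _ | ⟨q', (_ | _) | b⟩ <;> rw [hM] at he <;>
    simp only [actEdges, List.mem_singleton] at he <;> subst he
  · intro c hc
    obtain ⟨L, R, rfl, rfl⟩ := hc.of_head
    exact halts_of_step_none (step_cfg_none hM L R)
  · intro s'
    refine ⟨fun c b hs hc => ?_, fun c hs hc => ?_⟩
    · cases s' with
      -- The queue before the guess would consist of one letter that is not a head, and so represent
      -- no tape.
      | nil => obtain ⟨L, b, R, u, w, h1, -⟩ := hc; cases u <;> simp at h1
      | cons y s' =>
        simp only [List.cons_append, List.cons.injEq] at hs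
        obtain ⟨rfl, rfl⟩ := hs
        obtain ⟨L, R, hs, rfl⟩ := hc.of_cons_head (by simp)
        obtain ⟨L', rfl, rfl⟩ := append_plain_eq_ring hs
        refine halts_of_step_some (step_cfg_left hM _ R) (h _ ?_)
        exact ⟨L', b, a :: R, ring L' R, [plain a], by simp, by simp [ring], rfl⟩
    · cases s' with
      | nil => obtain ⟨L, b, R, u, w, h1, -⟩ := hc; cases u <;> simp at h1
      | cons y s' =>
        simp only [List.cons_append, List.cons.injEq] at hs
        obtain ⟨rfl, rfl⟩ := hs
        obtain ⟨L, R, hs, rfl⟩ := hc.of_cons_head (by simp)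
        obtain ⟨rfl, rfl⟩ := append_sep_eq_ring hs
        refine halts_of_step_some (step_cfg_left hM _ R) (h _ ?_)
        exact ⟨[], default, a :: R, R.map plain ++ [sep], [plain a], by simp, by simp [ring], rfl⟩
  · intro c hc
    obtain ⟨L, R, rfl, rfl⟩ := hc.of_head
    exact halts_of_step_some (step_cfg_right hM L R) (h _ _ (by simp [ring]))
  · intro c hc
    obtain ⟨L, R, rfl, rfl⟩ := hc.of_head
    refine halts_of_step_some (step_cfg_write hM L R) (h _ ?_)
    exact ⟨L, b, R, ring L R, [], rfl, rfl, rfl⟩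

theorem sound_move {M : TM0.Machine Γ Λ} {q : Λ} {a : Γ}
    {e : QueueEdge (State Λ) (Letter Γ)} (he : e ∈ moveEdges q a) {s : List (Letter Γ)}
    (h : Sound M e.target (s ++ e.write)) : Sound M e.source (e.read :: s) := by
  simp only [moveEdges, List.mem_cons, List.not_mem_nil, or_false] at he
  rcases he with rfl | rfl | rfl | rfl | rfl | rfl | rfl | rfl
  · exact fun c hc => h c (hc.rotate (by simp))
  · intro L R hs
    cases R with
    | nil => simp [ring] at hs
    | cons b R =>
      simp only [ring, List.map_cons, List.cons_append, List.cons.injEq, plain.injEq] at hs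
      exact h _ ⟨L, a, R, s, [], rfl, by simp [hs.2, ring], by simp [hs.1]⟩
  · exact fun c hc => (h s).1 c a rfl hc
  · trivial
  · exact fun c hc => h c (hc.rotate (by simp))
  · intro L R hs
    cases R with
    | cons b R => simp [ring] at hs
    | nil =>
      simp only [ring, List.map_nil, List.nil_append, List.cons.injEq, true_and] at hs
      exact h _ ⟨L, default, [], s, [sep], by simp, by simp [hs, ring], rfl⟩
  · exact fun c hc => (h s).2 c rfl hc
  · trivial

/-- This makes the spurious paths allowed by `Accepts` harmless: an empty queue represents no tape,
so every clause is vacuous. -/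
theorem sound_nil (M : TM0.Machine Γ Λ) (p : State Λ) : Sound M p [] := by
  cases p with
  | scan q => rintro c ⟨L, b, R, u, w, h1, -⟩; simp at h1
  | mark q => exact fun L R h => absurd h.symm (ring_ne_nil L R)
  | left q => exact fun s' => ⟨fun c a h => by simp at h, fun c h => by simp at h⟩
  | halt => trivial

variable [Fintype Λ] [Fintype Γ]

/-- Soundness is trivial at `halt`, and also wherever the queue runs empty; from there it is pulled
back edge by edge. -/
theorem sound_of_accepts {M : TM0.Machine Γ Λ} {p : State Λ} {s : List (Letter Γ)}
    (h : QueueEdge.Accepts (edges M) p s halt) : Sound M p s := by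
  obtain ⟨l, hl, h⟩ := h
  generalize hr : (halt : State Λ) = r at hl
  induction hl generalizing s with
  | nil q => subst hr; trivial
  | @cons e l q he hl ih =>
    cases s with
    | nil => exact sound_nil M _
    | cons x s =>
      simp only [List.map_cons, List.cons_append, List.flatMap_cons, List.cons.injEq] at h
      obtain ⟨rfl, h⟩ := h
      have := ih (s := s ++ e.write) (by simp [h]) hr
      obtain ⟨q, a, he | he⟩ := mem_edges.1 he
      · exact sound_act he this
      · exact sound_move he this

/-! ### Completeness: a halting computation yields an accepting path -/

open QueueEdge

theorem accepts_of_act {M : TM0.Machine Γ Λ} {q : Λ} {a : Γ}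
    {e : QueueEdge (State Λ) (Letter Γ)} (he : e ∈ actEdges q a (M q a)) {s : List (Letter Γ)}
    {r : State Λ} (h : Accepts (edges M) e.target (s ++ e.write) r) :
    Accepts (edges M) e.source (e.read :: s) r :=
  h.cons (mem_edges.2 ⟨q, a, .inl he⟩)

theorem accepts_of_move {M : TM0.Machine Γ Λ} {q : Λ} {a : Γ}
    {e : QueueEdge (State Λ) (Letter Γ)} (he : e ∈ moveEdges q a) {s : List (Letter Γ)}
    {r : State Λ} (h : Accepts (edges M) e.target (s ++ e.write) r) :
    Accepts (edges M) e.source (e.read :: s) r :=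
  h.cons (mem_edges.2 ⟨q, a, .inr he⟩)

theorem accepts_halt (M : TM0.Machine Γ Λ) (s : List (Letter Γ)) (hs : ∀ a, head a ∉ s) :
    Accepts (edges M) halt s halt := by
  induction s with
  | nil => exact .nil _ _
  | cons x s ih =>
    have ih := ih fun a ha => hs a (List.mem_cons_of_mem _ ha)
    cases x with
    | plain a =>
      exact accepts_of_move (q := default) (a := a) (e := ⟨halt, plain a, [], halt⟩)
        (by simp [moveEdges]) (by simpa using ih)
    | head a => exact absurd (List.mem_cons_self) (hs a)
    | sep =>
      exact accepts_of_move (q := default) (a := default) (e := ⟨halt, sep, [], halt⟩)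
        (by simp [moveEdges]) (by simpa using ih)

theorem accepts_rotate {M : TM0.Machine Γ Λ} {q : Λ} {r : State Λ} {s t : List (Letter Γ)}
    (ht : ∀ a, head a ∉ t) (h : Accepts (edges M) (scan q) (s ++ t) r) :
    Accepts (edges M) (scan q) (t ++ s) r := by
  induction t generalizing s with
  | nil => simpa using h
  | cons x t ih =>
    have ih := ih (s := s ++ [x]) (fun a ha => ht a (List.mem_cons_of_mem _ ha)) (by simpa using h)
    rw [← List.append_assoc] at ih
    cases x with
    | plain a =>
      exact accepts_of_move (q := q) (a := a) (e := ⟨scan q, plain a, [plain a], scan q⟩)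
        (by simp [moveEdges]) ih
    | head a => exact absurd (List.mem_cons_self) (ht a)
    | sep =>
      exact accepts_of_move (q := q) (a := default) (e := ⟨scan q, sep, [sep], scan q⟩)
        (by simp [moveEdges]) ih

omit [Inhabited Λ] [Inhabited Γ] [Fintype Λ] [Fintype Γ] in
theorem head_notMem_of_ring {u w : List (Letter Γ)} {L R : List Γ} (h : w ++ u = ring L R)
    (a : Γ) : head a ∉ u := fun ha => head_notMem_ring L R a (h ▸ List.mem_append_right _ ha)

/-- Induction on the computation. The condition `u ≠ []` keeps a letter in front of the head, on
which a left move can be guessed; every simulated step restores it. -/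
theorem accepts_of_halts {M : TM0.Machine Γ Λ} {c d : TM0.Cfg Γ Λ}
    (h : StateTransition.Reaches (TM0.step M) c d) (hd : TM0.step M d = none) {q : Λ} {a : Γ}
    {L R : List Γ} {u w : List (Letter Γ)} (hc : c = cfg q L a R) (hu : u ≠ [])
    (hr : w ++ u = ring L R) : Accepts (edges M) (scan q) (u ++ head a :: w) halt := by
  induction h using Relation.ReflTransGen.head_induction_on generalizing q a L R u w with
  | refl =>
    subst hc
    have hM : M q a = none := by simpa [TM0.step, cfg] using hd
    refine accepts_rotate (head_notMem_of_ring hr) ?_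
    rw [List.cons_append, hr]
    refine accepts_of_act (q := q) (a := a) (e := ⟨scan q, head a, [], halt⟩)
      (by simp [hM, actEdges]) (accepts_halt M _ ?_)
    simpa using head_notMem_ring L R
  | @head c c' hs _ ih =>
    subst hc
    rcases hM : M q a with _ | ⟨q', (_ | _) | b⟩
    · rw [step_cfg_none hM] at hs; simp at hs
    · rw [step_cfg_left hM] at hs
      -- `x` is the letter just before the head. The rest is rotated away, and the guess is made on
      -- `x`.
      obtain ⟨u, x, rfl⟩ := List.eq_nil_or_concat u |>.resolve_left hu
      rw [List.concat_eq_append, List.append_assoc]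
      refine accepts_rotate (fun a ha => head_notMem_of_ring hr a (by simp [ha])) ?_
      have hr' : (w ++ u) ++ [x] = ring L R := by simpa using hr
      have hact (s : List (Letter Γ)) (h : Accepts (edges M) (scan q') (s ++ [plain a]) halt) :=
        accepts_of_act (q := q) (a := a) (e := ⟨left q, head a, [plain a], scan q'⟩)
          (by simp [hM, actEdges]) h
      cases x with
      | head b => exact absurd (hr' ▸ by simp) (head_notMem_ring L R b)
      | plain b =>
        obtain ⟨L, rfl, hwu⟩ := append_plain_eq_ring hr'
        refine accepts_of_move (q := q) (a := b) (e := ⟨scan q, plain b, [head b], left q⟩)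
          (by simp [moveEdges]) (hact _ ?_)
        have := ih (u := ring L R) (w := [plain a]) (Option.some.inj hs).symm (ring_ne_nil L R)
          (by simp [ring])
        simpa [← hwu] using this
      | sep =>
        obtain ⟨rfl, hwu⟩ := append_sep_eq_ring hr'
        refine accepts_of_move (q := q) (a := default)
          (e := ⟨scan q, sep, [sep, head default], left q⟩) (by simp [moveEdges]) (hact _ ?_)
        have := ih (u := ring [] R) (w := [plain a]) (Option.some.inj hs).symm (ring_ne_nil [] R)
          (by simp [ring])
        simpa [ring, ← hwu] using this
    · rw [step_cfg_right hM] at hs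
      refine accepts_rotate (head_notMem_of_ring hr) ?_
      rw [List.cons_append, hr]
      refine accepts_of_act (q := q) (a := a) (e := ⟨scan q, head a, [plain a], mark q'⟩)
        (by simp [hM, actEdges]) ?_
      cases R with
      | nil =>
        refine accepts_of_move (q := q') (a := default)
          (e := ⟨mark q', sep, [head default, sep], scan q'⟩) (by simp [moveEdges]) ?_
        -- The tape grows by a blank at its right end, so the new head stands just before the mark.
        have := ih (u := L.reverse.map plain ++ [plain a]) (w := [sep]) (Option.some.inj hs).symm
          (by simp) (by simp [ring])
        simpa using this
      | cons b R =>
        refine accepts_of_move (q := q') (a := b)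
          (e := ⟨mark q', plain b, [head b], scan q'⟩) (by simp [moveEdges]) ?_
        have := ih (u := ring (a :: L) R) (w := []) (Option.some.inj hs).symm (ring_ne_nil _ _)
          (by simp [ring])
        simpa [ring] using this
    · rw [step_cfg_write hM] at hs
      refine accepts_rotate (head_notMem_of_ring hr) ?_
      rw [List.cons_append, hr]
      refine accepts_of_act (q := q) (a := a) (e := ⟨scan q, head a, [head b], scan q'⟩)
        (by simp [hM, actEdges]) ?_
      exact ih (u := ring L R) (w := []) (Option.some.inj hs).symm (ring_ne_nil _ _) rfl

/-- The queue that represents the input `l`. -/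
def inputQueue (l : List Γ) : List (Letter Γ) :=
  sep :: head l.headI :: l.tail.map plain

/-- The queue machine accepts the input iff the Turing machine halts on it. -/
theorem accepts_iff (M : TM0.Machine Γ Λ) (l : List Γ) :
    Accepts (edges M) (scan default) (inputQueue l) halt ↔ (TM0.eval M l).Dom := by
  have hc : TM0.init l = cfg (default : Λ) [] l.headI l.tail := rfl
  have hr : l.tail.map plain ++ [sep] = ring [] l.tail := by simp [ring]
  change _ ↔ Halts M (TM0.init l)
  constructor
  · intro h
    exact sound_of_accepts h _ ⟨[], l.headI, l.tail, [sep], l.tail.map plain, rfl, hr, hc⟩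
  · intro h
    obtain ⟨b, hb⟩ := Part.dom_iff_mem.1 h
    obtain ⟨h1, h2⟩ := StateTransition.mem_eval.1 hb
    exact accepts_of_halts h1 h2 hc (by simp) hr

end TapeQueue

/-! ### The one-reversal automaton of a queue machine -/

namespace QueueEdge

/-- Queue machine transitions as tuples. -/
def equivProd (Q A : Type*) : QueueEdge Q A ≃ Q × A × List A × Q where
  toFun e := (e.source, e.read, e.write, e.target)
  invFun p := ⟨p.1, p.2.1, p.2.2.1, p.2.2.2⟩
  left_inv _ := rfl
  right_inv _ := rfl

instance {Q A : Type*} [Encodable Q] [Encodable A] : Encodable (QueueEdge Q A) :=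
  Encodable.ofEquiv _ (equivProd Q A)

end QueueEdge

namespace CopyAutomaton

open Encodable QueueEdge

variable {Q A : Type*} [Encodable Q] [Encodable A]

/-- The stack symbol for a queue letter. The stack symbols `0` and `1` are the bottom symbol and a
separator. -/
def symbol (a : A) : ℕ := encode a + 2

/-- The input letter for a transition of the queue machine. The input letter `0` is a separator. -/
def edgeLetter (e : QueueEdge Q A) : ℕ := 2 * encode e + 1

/-- The input letter for a queue letter. -/
def queueLetter (a : A) : ℕ := 2 * encode a + 2

theorem symbol_injective : Function.Injective (symbol : A → ℕ) := fun a b h => by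
  simpa [symbol] using h

theorem edgeLetter_injective : Function.Injective (edgeLetter : QueueEdge Q A → ℕ) :=
  fun a b h => by simpa [edgeLetter] using h

theorem queueLetter_injective : Function.Injective (queueLetter : A → ℕ) := fun a b h => by
  simpa [queueLetter] using h

/-- The stack symbols of the automaton. -/
def symbols (B : List A) : List ℕ := 0 :: 1 :: B.map symbol

/-- The transitions of the automaton that do not depend on the initial queue. On a word
`l $ y` followed by its copy, the first half is pushed, as the letters written by the path `l` and
the word `y`; in the second half, `l` pops the letters it reads against `y` and `y` is popped
against the letters written. -/
def coreTransitions (E : List (QueueEdge Q A)) (B : List A) (pf : Q) :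
    List (PDATransition MarkedLetter ℕ ℕ) :=
  (E.flatMap fun e => (symbols B).map fun b =>
    ⟨encode e.source + 5, some (.inl (edgeLetter e)), b, encode e.target + 5,
      (e.write.map symbol).reverse ++ [b]⟩) ++
  ((symbols B).map fun b => ⟨encode pf + 5, some (.inl 0), b, 1, [1, b]⟩) ++
  (B.flatMap fun a => (symbols B).map fun b =>
    ⟨1, some (.inl (queueLetter a)), b, 1, [symbol a, b]⟩) ++
  (E.flatMap fun e => [1, 2].map fun q =>
    ⟨q, some (.inr (edgeLetter e)), symbol e.read, 2, []⟩) ++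
  ([1, 2].map fun q => ⟨q, some (.inr 0), 1, 3, []⟩) ++
  (B.map fun a => ⟨3, some (.inr (queueLetter a)), symbol a, 3, []⟩) ++
  [⟨3, none, 0, 4, []⟩]

/-- The automaton for the queue machine with transitions `E` over the alphabet `B`, started in the
state `p` with the queue whose reversed code is `z`, and accepting in the state `pf`. -/
def automaton (E : List (QueueEdge Q A)) (B : List A) (p pf : Q) (z : List ℕ) :
    PDA MarkedLetter ℕ ℕ where
  start := 0
  bottom := 0
  accept := [4]
  transitions := ⟨0, none, 0, encode p + 5, z ++ [0]⟩ :: coreTransitions E B pf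

/-- The transitions of the automaton, case by case. -/
inductive IsTransition (E : List (QueueEdge Q A)) (B : List A) (p pf : Q) (z : List ℕ) :
    PDATransition MarkedLetter ℕ ℕ → Prop
  | start : IsTransition E B p pf z ⟨0, none, 0, encode p + 5, z ++ [0]⟩
  | pushEdge (e : QueueEdge Q A) (he : e ∈ E) (b : ℕ) (hb : b ∈ symbols B) :
      IsTransition E B p pf z ⟨encode e.source + 5, some (.inl (edgeLetter e)), b,
        encode e.target + 5, (e.write.map symbol).reverse ++ [b]⟩
  | pushSep (b : ℕ) (hb : b ∈ symbols B) :
      IsTransition E B p pf z ⟨encode pf + 5, some (.inl 0), b, 1, [1, b]⟩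
  | pushLetter (a : A) (ha : a ∈ B) (b : ℕ) (hb : b ∈ symbols B) :
      IsTransition E B p pf z ⟨1, some (.inl (queueLetter a)), b, 1, [symbol a, b]⟩
  | popEdge (e : QueueEdge Q A) (he : e ∈ E) (q : ℕ) (hq : q = 1 ∨ q = 2) :
      IsTransition E B p pf z ⟨q, some (.inr (edgeLetter e)), symbol e.read, 2, []⟩
  | popSep (q : ℕ) (hq : q = 1 ∨ q = 2) : IsTransition E B p pf z ⟨q, some (.inr 0), 1, 3, []⟩
  | popLetter (a : A) (ha : a ∈ B) :
      IsTransition E B p pf z ⟨3, some (.inr (queueLetter a)), symbol a, 3, []⟩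
  | finish : IsTransition E B p pf z ⟨3, none, 0, 4, []⟩

variable {E : List (QueueEdge Q A)} {B : List A} {p pf : Q} {z : List ℕ}

theorem isTransition_of_mem {t : PDATransition MarkedLetter ℕ ℕ}
    (h : t ∈ (automaton E B p pf z).transitions) : IsTransition E B p pf z t := by
  simp only [automaton, coreTransitions, List.mem_cons, List.mem_append, List.mem_flatMap,
    List.mem_map, List.not_mem_nil, or_false] at h
  rcases h with rfl | (((((⟨e, he, b, hb, rfl⟩ | ⟨b, hb, rfl⟩) | ⟨a, ha, b, hb, rfl⟩) |
    ⟨e, he, q, hq, rfl⟩) | ⟨q, hq, rfl⟩) | ⟨a, ha, rfl⟩) | rfl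
  · exact .start
  · exact .pushEdge e he b hb
  · exact .pushSep b hb
  · exact .pushLetter a ha b hb
  · exact .popEdge e he q hq
  · exact .popSep q hq
  · exact .popLetter a ha
  · exact .finish

theorem IsTransition.mem {t : PDATransition MarkedLetter ℕ ℕ} (h : IsTransition E B p pf z t) :
    t ∈ (automaton E B p pf z).transitions := by
  simp only [automaton, coreTransitions, List.mem_cons, List.mem_append, List.mem_flatMap,
    List.mem_map, List.not_mem_nil, or_false]
  cases h with
  | start => exact .inl rfl
  | pushEdge e he b hb =>
    exact .inr <| .inl <| .inl <| .inl <| .inl <| .inl <| .inl ⟨e, he, b, hb, rfl⟩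
  | pushSep b hb => exact .inr <| .inl <| .inl <| .inl <| .inl <| .inl <| .inr ⟨b, hb, rfl⟩
  | pushLetter a ha b hb => exact .inr <| .inl <| .inl <| .inl <| .inl <| .inr ⟨a, ha, b, hb, rfl⟩
  | popEdge e he q hq => exact .inr <| .inl <| .inl <| .inl <| .inr ⟨e, he, q, hq, rfl⟩
  | popSep q hq => exact .inr <| .inl <| .inl <| .inr ⟨q, hq, rfl⟩
  | popLetter a ha => exact .inr <| .inl <| .inr ⟨a, ha, rfl⟩
  | finish => exact .inr <| .inr rfl

/-- The input letter determines the edge or queue letter, and its parity or vanishing separates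
edges, queue letters and the separator. Of the two ε-moves, one is alone in state `0`; the other
needs the bottom symbol in state `3`, where letters pop only symbols that are at least `2`. -/
theorem isDeterministic : (automaton E B p pf z).IsDeterministic := by
  intro t ht t' ht' hs hp hr
  have hinj := @edgeLetter_injective Q A _ _
  have hinj' := @queueLetter_injective A _
  cases isTransition_of_mem ht with
  | start =>
    cases isTransition_of_mem ht' with
    | popEdge => simp only at hs; omega
    | popSep => simp only at hs; omega
    | _ => simp_all
  | pushEdge e he b hb =>
    cases isTransition_of_mem ht' with
    | pushEdge e' => simp_all [hinj.eq_iff]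
    | _ => simp_all [edgeLetter]
  | pushSep b hb => cases isTransition_of_mem ht' <;> simp_all [edgeLetter]
  | pushLetter a ha b hb =>
    cases isTransition_of_mem ht' with
    | pushLetter a' => simp_all [hinj'.eq_iff]
    | _ => simp_all
  | popEdge e he q hq =>
    cases isTransition_of_mem ht' with
    | popEdge e' => simp_all [hinj.eq_iff]
    | _ => simp_all [edgeLetter]
  | popSep q hq =>
    cases isTransition_of_mem ht' with
    | popSep => simp_all
    | popEdge => simp [edgeLetter] at hr
    | start => simp only at hs; omega
    | pushEdge => simp only at hs; omega
    | _ => simp_all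
  | popLetter a ha =>
    cases isTransition_of_mem ht' with
    | popLetter a' => simp_all [hinj'.eq_iff]
    | _ => simp_all [symbol] <;> omega
  | finish => cases isTransition_of_mem ht' <;> simp_all [symbol]

/-- The states of the popping phase. -/
def IsLate (q : ℕ) : Prop := q = 2 ∨ q = 3 ∨ q = 4

theorem IsTransition.late_of_late {t : PDATransition MarkedLetter ℕ ℕ}
    (h : IsTransition E B p pf z t) (hs : IsLate t.source) : IsLate t.target ∧ t.push = [] := by
  cases h <;> simp_all [IsLate]

theorem IsTransition.late_of_pop {t : PDATransition MarkedLetter ℕ ℕ}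
    (h : IsTransition E B p pf z t) (hs : t.push = []) : IsLate t.target := by
  cases h <;> simp_all [IsLate]

/-- A step that lowers the stack pushes the empty word and so enters a late state; late states lead
only to late states and push nothing. -/
theorem isLinear : (automaton E B p pf z).IsLinear := by
  rintro w a b c d - ⟨t, ht, u, s, rfl, rfl⟩ hbc ⟨t', ht', u', s', rfl, rfl⟩ hlt
  have hb : IsLate t.target := by
    refine (isTransition_of_mem ht).late_of_pop (List.length_eq_zero_iff.1 ?_)
    simp only [List.length_append, List.length_cons] at hlt
    omega
  have hc : IsLate t'.source := by
    refine Relation.ReflTransGen.head_induction_on (motive := fun c _ => IsLate c.state →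
      IsLate t'.source) hbc (fun h => h) ?_ hb
    rintro _ _ ⟨t'', ht'', x, y, rfl, rfl⟩ _ ih h
    exact ih ((isTransition_of_mem ht'').late_of_late h).1
  simp [((isTransition_of_mem ht').late_of_late hc).2]

/-! ### Soundness of the automaton: an invariant of its computations -/

/-- The word that describes a path `l` and a queue content `y`. -/
def pathWord (l : List (QueueEdge Q A)) (y : List A) : List ℕ :=
  l.map edgeLetter ++ 0 :: y.map queueLetter

theorem append_cons_inj {α : Type*} {a : α} {u v s t : List α} (hu : a ∉ u) (hv : a ∉ v)
    (h : u ++ a :: s = v ++ a :: t) : u = v ∧ s = t := by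
  induction u generalizing v with
  | nil =>
    cases v with
    | nil => exact ⟨rfl, (List.cons.inj h).2⟩
    | cons y v => exact absurd ((List.cons.inj h).1 ▸ List.mem_cons_self) hv
  | cons x u ih =>
    cases v with
    | nil => exact absurd ((List.cons.inj h).1 ▸ List.mem_cons_self) hu
    | cons y v =>
      obtain ⟨h1, h2⟩ := List.cons.inj h
      obtain ⟨h3, h4⟩ := ih (List.not_mem_of_not_mem_cons hu) (List.not_mem_of_not_mem_cons hv) h2
      exact ⟨by rw [h1, h3], h4⟩

theorem zero_notMem_map_symbol (l : List A) : 0 ∉ l.map symbol := by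
  simp only [symbol, List.mem_map]
  rintro ⟨a, -, h⟩
  omega

theorem one_notMem_map_symbol (l : List A) : 1 ∉ l.map symbol := by
  simp only [symbol, List.mem_map]
  rintro ⟨a, -, h⟩
  omega

theorem zero_notMem_map_edgeLetter (l : List (QueueEdge Q A)) : 0 ∉ l.map edgeLetter := by
  simp [edgeLetter]

theorem pathWord_inj {l k : List (QueueEdge Q A)} {y v : List A}
    (h : pathWord l y = pathWord k v) : l = k ∧ y = v := by
  obtain ⟨h1, h2⟩ := append_cons_inj (zero_notMem_map_edgeLetter l)
    (zero_notMem_map_edgeLetter k) h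
  exact ⟨List.map_injective_iff.2 edgeLetter_injective h1,
    List.map_injective_iff.2 queueLetter_injective h2⟩

/-- The stack after the path `l` has been read, with the initial queue `s`. -/
def pathStack (s : List A) (l : List (QueueEdge Q A)) : List ℕ :=
  ((s ++ l.flatMap write).map symbol).reverse ++ [0]

/-- The configurations that are reachable from the initial one on the input `U`. -/
inductive Reachable (E : List (QueueEdge Q A)) (p pf : Q) (s : List A) (U : List MarkedLetter) :
    PDAConfig MarkedLetter ℕ ℕ → Prop
  | start : Reachable E p pf s U ⟨0, U, [0]⟩
  | path {q : ℕ} {r : List MarkedLetter} {st : List ℕ} (l : List (QueueEdge Q A)) (p' : Q)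
      (hl : IsPath E p l p') (hq : q = encode p' + 5)
      (hU : U = (l.map edgeLetter).map .inl ++ r) (hst : st = pathStack s l) :
      Reachable E p pf s U ⟨q, r, st⟩
  | copy {q : ℕ} {r : List MarkedLetter} {st : List ℕ} (l : List (QueueEdge Q A)) (y : List A)
      (hl : IsPath E p l pf) (hq : q = 1) (hU : U = (pathWord l y).map .inl ++ r)
      (hst : st = (y.map symbol).reverse ++ 1 :: pathStack s l) : Reachable E p pf s U ⟨q, r, st⟩
  | popPath {q : ℕ} {r : List MarkedLetter} {st : List ℕ} (l k : List (QueueEdge Q A))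
      (y : List A) (hl : IsPath E p l pf) (hq : q = 2)
      (hU : U = (pathWord l y).map .inl ++ (k.map edgeLetter).map .inr ++ r)
      (hst : (k.map read).map symbol ++ st = (y.map symbol).reverse ++ 1 :: pathStack s l) :
      Reachable E p pf s U ⟨q, r, st⟩
  | popCopy {q : ℕ} {r : List MarkedLetter} {st : List ℕ} (l k : List (QueueEdge Q A))
      (y v : List A) (hl : IsPath E p l pf) (hk : k.map read = y.reverse) (hq : q = 3)
      (hU : U = (pathWord l y).map .inl ++ (pathWord k v).map .inr ++ r)
      (hst : v.map symbol ++ st = pathStack s l) : Reachable E p pf s U ⟨q, r, st⟩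
  | finish {q : ℕ} {r : List MarkedLetter} {st : List ℕ} (l k : List (QueueEdge Q A))
      (y v : List A) (hl : IsPath E p l pf) (hk : k.map read = y.reverse) (hq : q = 4)
      (hU : U = (pathWord l y).map .inl ++ (pathWord k v).map .inr ++ r)
      (hst : v = (s ++ l.flatMap write).reverse) : Reachable E p pf s U ⟨q, r, st⟩

-- The symbol `1` codes no queue letter, so it surfaces exactly when all of `y` has been popped.
omit [Encodable Q] in
theorem pop_separator {k l : List (QueueEdge Q A)} {y s : List A} {st : List ℕ}
    (h : (k.map read).map symbol ++ 1 :: st = (y.map symbol).reverse ++ 1 :: pathStack s l) :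
    k.map read = y.reverse ∧ st = pathStack s l := by
  rw [← List.map_reverse] at h
  obtain ⟨h1, h2⟩ := append_cons_inj (one_notMem_map_symbol _) (one_notMem_map_symbol _) h
  exact ⟨List.map_injective_iff.2 symbol_injective h1, h2⟩

/-- The state number tells the phase. The data `k`, `v` of the marked half are kept apart from `l`,
`y`, since the invariant covers arbitrary inputs, not only copies. -/
theorem Reachable.step {s : List A} {U : List MarkedLetter} {c d : PDAConfig MarkedLetter ℕ ℕ}
    (hc : Reachable E p pf s U c)
    (h : (automaton E B p pf (s.map symbol).reverse).Step c d) : Reachable E p pf s U d := by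
  obtain ⟨t, ht, w, x, rfl, rfl⟩ := h
  cases isTransition_of_mem ht with
  | start =>
    simp only [Option.toList_none, List.nil_append] at hc ⊢
    cases hc with
    | start => exact .path [] p (.nil p) rfl rfl (by simp [pathStack])
    | path l p' hl hq => omega
    | _ => simp_all
  | pushEdge e he b hb =>
    simp only [Option.toList_some, List.cons_append, List.nil_append] at hc ⊢
    cases hc with
    | path l p' hl hq hU hst =>
      have hp : e.source = p' := by simpa using hq
      exact .path (l ++ [e]) e.target (hl.snoc he hp) rfl (by simp [hU])
        (by simp [hst, pathStack])
    | _ => omega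
  | pushSep b hb =>
    simp only [Option.toList_some, List.cons_append, List.nil_append] at hc ⊢
    cases hc with
    | path l p' hl hq hU hst =>
      have hp : pf = p' := by simpa using hq
      subst hp
      exact .copy l [] hl rfl (by simp [hU, pathWord]) (by simp [hst])
    | _ => omega
  | pushLetter a ha b hb =>
    simp only [Option.toList_some, List.cons_append, List.nil_append] at hc ⊢
    cases hc with
    | path l p' hl hq => omega
    | copy l y hl hq hU hst =>
      exact .copy l (y ++ [a]) hl rfl (by simp [hU, pathWord]) (by simp [hst])
    | _ => omega
  | popEdge e he q hq' =>
    simp only [Option.toList_some, List.cons_append, List.nil_append] at hc ⊢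
    cases hc with
    | path l p' hl hq => omega
    | copy l y hl hq hU hst =>
      exact .popPath l [e] y hl rfl (by simp [hU]) (by simp [← hst])
    | popPath l k y hl hq hU hst =>
      exact .popPath l (k ++ [e]) y hl rfl (by simp [hU]) (by simp [← hst])
    | _ => omega
  | popSep q hq' =>
    simp only [Option.toList_some, List.cons_append, List.nil_append] at hc ⊢
    cases hc with
    | path l p' hl hq => omega
    | copy l y hl hq hU hst =>
      obtain ⟨h1, h2⟩ := pop_separator (k := []) (by simpa using hst)
      exact .popCopy l [] y [] hl h1 rfl (by simp [hU, pathWord]) (by simpa using h2)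
    | popPath l k y hl hq hU hst =>
      obtain ⟨h1, h2⟩ := pop_separator hst
      exact .popCopy l k y [] hl h1 rfl (by simp [hU, pathWord]) (by simpa using h2)
    | _ => omega
  | popLetter a ha =>
    simp only [Option.toList_some, List.cons_append, List.nil_append] at hc ⊢
    cases hc with
    | path l p' hl hq => omega
    | popCopy l k y v hl hk hq hU hst =>
      exact .popCopy l k y (v ++ [a]) hl hk rfl (by simp [hU, pathWord]) (by simp [← hst])
    | _ => omega
  | finish =>
    simp only [Option.toList_none, List.nil_append] at hc ⊢
    cases hc with
    | path l p' hl hq => omega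
    | popCopy l k y v hl hk hq hU hst =>
      -- The bottom symbol `0` is on top, so `v` has matched the whole stored queue content.
      refine .finish l k y v hl hk rfl hU ?_
      rw [pathStack, ← List.map_reverse] at hst
      exact List.map_injective_iff.2 symbol_injective
        (append_cons_inj (zero_notMem_map_symbol _) (zero_notMem_map_symbol _) hst).1
    | _ => omega

theorem inl_append_inr_inj {α β : Type*} {u u' : List α} {v v' : List β}
    (h : u.map Sum.inl ++ v.map Sum.inr = u'.map Sum.inl ++ v'.map (Sum.inr : β → α ⊕ β)) :
    u = u' ∧ v = v' := by
  have h1 := congrArg (List.filterMap Sum.getLeft?) h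
  have h2 := congrArg (List.filterMap Sum.getRight?) h
  simp only [List.filterMap_append, List.filterMap_map] at h1 h2
  simpa [Function.comp_def] using And.intro h1 h2

/-- Only here is the input a copy: this identifies `k` with `l` and `v` with `y`, and the two stack
comparisons become the equation in `Accepts`. -/
theorem accepts_of_mem_language {s : List A} {w : List ℕ}
    (h : unmarkedWord w ++ markedCopy w ∈
      (automaton E B p pf (s.map symbol).reverse).language) : Accepts E p s pf := by
  obtain ⟨q, hq, st, h⟩ := h
  have hr : Reachable E p pf s (unmarkedWord w ++ markedCopy w) ⟨q, [], st⟩ := by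
    refine Relation.ReflTransGen.head_induction_on (motive := fun c _ =>
      Reachable E p pf s (unmarkedWord w ++ markedCopy w) c →
      Reachable E p pf s (unmarkedWord w ++ markedCopy w) ⟨q, [], st⟩) h (fun h => h) ?_ .start
    exact fun hs _ ih h => ih (h.step hs)
  have hq : q = 4 := by simpa [automaton] using hq
  generalize hU' : unmarkedWord w ++ markedCopy w = U, hr' : ([] : List MarkedLetter) = r at hr
  cases hr with
  | path l p' hl hq => omega
  | finish l k y v hl hk hq hU hst =>
    rw [← hr', List.append_nil, ← hU'] at hU
    obtain ⟨h1, h2⟩ := inl_append_inr_inj hU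
    obtain ⟨rfl, rfl⟩ := pathWord_inj (h1.symm.trans h2)
    exact ⟨l, hl, by rw [hk, hst, List.reverse_reverse]⟩
  | _ => omega

/-! ### Completeness of the automaton: the accepting run on a copy -/

section Completeness

open Relation

theorem reaches_transition {t : PDATransition MarkedLetter ℕ ℕ} (h : IsTransition E B p pf z t)
    (w : List MarkedLetter) (x : List ℕ) {d : PDAConfig MarkedLetter ℕ ℕ}
    (hd : (automaton E B p pf z).Reaches ⟨t.target, w, t.push ++ x⟩ d) :
    (automaton E B p pf z).Reaches ⟨t.source, t.read.toList ++ w, t.pop :: x⟩ d :=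
  ReflTransGen.head ⟨t, h.mem, w, x, rfl, rfl⟩ hd

theorem mem_symbols (hB : ∀ a, a ∈ B) (a : A) : symbol a ∈ symbols B := by
  simp only [symbols, List.mem_cons, List.mem_map]
  exact .inr (.inr ⟨a, hB a, rfl⟩)

theorem reaches_path (hB : ∀ a, a ∈ B) {q q' : Q} {l : List (QueueEdge Q A)}
    (hl : IsPath E q l q') (r : List MarkedLetter) {st : List ℕ} (hst : st ≠ [])
    (hs : ∀ x ∈ st, x ∈ symbols B) :
    (automaton E B p pf z).Reaches ⟨encode q + 5, (l.map edgeLetter).map .inl ++ r, st⟩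
      ⟨encode q' + 5, r, ((l.flatMap write).map symbol).reverse ++ st⟩ := by
  induction hl generalizing st with
  | nil q => exact .refl
  | @cons e l q he hl ih =>
    obtain ⟨b, x, rfl⟩ := List.exists_cons_of_ne_nil hst
    refine reaches_transition (.pushEdge e he b (hs b (by simp))) _ x ?_
    have := ih (st := (e.write.map symbol).reverse ++ [b] ++ x) (by simp) (by
      intro c hc
      simp only [List.append_assoc, List.cons_append, List.nil_append, List.mem_append,
        List.mem_reverse, List.mem_map] at hc
      rcases hc with ⟨a, -, rfl⟩ | hc
      · exact mem_symbols hB a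
      · exact hs c hc)
    simpa using this

theorem reaches_copy (hB : ∀ a, a ∈ B) (y : List A) (r : List MarkedLetter) {st : List ℕ}
    (hst : st ≠ []) (hs : ∀ x ∈ st, x ∈ symbols B) :
    (automaton E B p pf z).Reaches ⟨1, (y.map queueLetter).map .inl ++ r, st⟩
      ⟨1, r, (y.map symbol).reverse ++ st⟩ := by
  induction y generalizing st with
  | nil => exact .refl
  | cons a y ih =>
    obtain ⟨b, x, rfl⟩ := List.exists_cons_of_ne_nil hst
    refine reaches_transition (.pushLetter a (hB a) b (hs b (by simp))) _ x ?_
    have := ih (st := symbol a :: b :: x) (by simp) (by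
      intro c hc
      rcases List.mem_cons.1 hc with rfl | hc
      · exact mem_symbols hB a
      · exact hs c hc)
    simpa using this

/-- Both states are needed: the first pop happens in the copying state `1`, and an empty path leaves
it by the separator. -/
theorem reaches_popPath {q : ℕ} (hq : q = 1 ∨ q = 2) {l : List (QueueEdge Q A)}
    (hl : ∀ e ∈ l, e ∈ E) (r : List MarkedLetter) (st : List ℕ) :
    (automaton E B p pf z).Reaches
      ⟨q, (l.map edgeLetter).map .inr ++ .inr 0 :: r, (l.map read).map symbol ++ 1 :: st⟩
      ⟨3, r, st⟩ := by
  induction l generalizing q with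
  | nil => exact reaches_transition (.popSep q hq) _ _ .refl
  | cons e l ih =>
    exact reaches_transition (.popEdge e (hl e (by simp)) q hq) _ _
      (ih (.inr rfl) fun e he => hl e (by simp [he]))

theorem reaches_popCopy (hB : ∀ a, a ∈ B) (v : List A) :
    (automaton E B p pf z).Reaches ⟨3, (v.map queueLetter).map .inr, v.map symbol ++ [0]⟩
      ⟨4, [], []⟩ := by
  induction v with
  | nil => exact reaches_transition .finish [] [] .refl
  | cons a v ih => exact reaches_transition (.popLetter a (hB a)) _ _ ih

omit [Encodable Q] [Encodable A] in
theorem IsPath.mem {q q' : Q} {l : List (QueueEdge Q A)} (h : IsPath E q l q') :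
    ∀ e ∈ l, e ∈ E := by
  induction h with
  | nil => simp
  | cons he _ ih => simpa using ⟨he, ih⟩

theorem mem_language_of_accepts (hB : ∀ a, a ∈ B) {s : List A} (h : Accepts E p s pf) :
    ∃ w, unmarkedWord w ++ markedCopy w ∈
      (automaton E B p pf (s.map symbol).reverse).language := by
  obtain ⟨l, hl, h⟩ := h
  -- Once pushed, `y` appears from the top as its reversal, the reads of `l`; below the separator
  -- the stack spells `y` itself.
  set y := (s ++ l.flatMap write).reverse with hy
  have hsym (x : ℕ) (hx : x ∈ pathStack s l) : x ∈ symbols B := by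
    simp only [pathStack, List.mem_append, List.mem_reverse, List.mem_map, List.mem_singleton]
      at hx
    rcases hx with ⟨a, -, rfl⟩ | rfl
    · exact mem_symbols hB a
    · simp [symbols]
  have hne : pathStack s l ≠ [] := by simp [pathStack]
  refine ⟨pathWord l y, 4, by simp [automaton], [], ?_⟩
  refine reaches_transition (IsTransition.start (E := E) (B := B))
    ((pathWord l y).map Sum.inl ++ (pathWord l y).map Sum.inr) [] ?_
  simp only [List.append_nil]
  rw [show (pathWord l y).map Sum.inl ++ (pathWord l y).map (Sum.inr : ℕ → MarkedLetter) =
    (l.map edgeLetter).map Sum.inl ++ (.inl 0 :: ((y.map queueLetter).map .inl ++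
      ((l.map edgeLetter).map .inr ++ .inr 0 :: (y.map queueLetter).map .inr))) by
      simp [pathWord]]
  refine (reaches_path hB hl _ (by simp) ?_).trans ?_
  · intro x hx
    refine hsym x ?_
    simp only [pathStack, List.map_append, List.reverse_append, List.append_assoc]
    exact List.mem_append_right _ hx
  rw [show ((l.flatMap write).map symbol).reverse ++ ((s.map symbol).reverse ++ [0]) =
    pathStack s l by simp [pathStack]]
  obtain ⟨b, x, hbx⟩ := List.exists_cons_of_ne_nil hne
  rw [hbx]
  refine reaches_transition (.pushSep b (hsym b (by simp [hbx]))) _ x ?_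
  simp only [List.cons_append, List.nil_append]
  rw [← hbx]
  refine (reaches_copy hB y _ (by simp) ?_).trans ?_
  · intro x hx
    rcases List.mem_cons.1 hx with rfl | hx
    · simp [symbols]
    · exact hsym x hx
  rw [← List.map_reverse (l := y), show y.reverse = l.map read by rw [h, hy, List.reverse_reverse]]
  refine (reaches_popPath (.inl rfl) (IsPath.mem hl) _ _).trans ?_
  rw [show pathStack s l = y.map symbol ++ [0] by rw [pathStack, hy, List.map_reverse]]
  exact reaches_popCopy hB y

end Completeness

/-- The automaton accepts a word followed by its marked copy iff the queue machine accepts. -/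
theorem exists_mem_language_iff (hB : ∀ a, a ∈ B) (s : List A) :
    (∃ w, unmarkedWord w ++ markedCopy w ∈
      (automaton E B p pf (s.map symbol).reverse).language) ↔ Accepts E p s pf :=
  ⟨fun ⟨_, h⟩ => accepts_of_mem_language h, mem_language_of_accepts hB⟩

end CopyAutomaton

/-! ### A finite Turing machine with an undecidable halting problem -/

namespace TapeQueue

open Turing

/-- The translations through `TM1` to `TM0` preserve finite support, and a computation never leaves
the supporting set. So the states can be cut down to it, all others being sent to the default. -/
theorem exists_finite_machine {K : Type} [DecidableEq K] [Finite K] {Γ : K → Type}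
    [∀ k, Finite (Γ k)] {Λ σ : Type} [Inhabited Λ] [Inhabited σ] [Finite σ]
    (M : Λ → TM2.Stmt Γ Λ σ) (S : Finset Λ) (hS : TM2.Supports M S) :
    ∃ (Λ₀ : Type) (_ : Inhabited Λ₀) (_ : Fintype Λ₀)
      (M₀ : TM0.Machine (TM2to1.Γ' K Γ) Λ₀), ∀ k L,
        (TM0.eval M₀ (TM2to1.trInit k L)).Dom ↔ (TM2.eval M k L).Dom := by
  classical
  cases nonempty_fintype σ
  have hS0 := TM1to0.tr_supports _ (TM2to1.tr_supports M hS)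
  set N := TM1to0.tr (TM2to1.tr M)
  set T := TM1to0.trStmts (TM2to1.tr M) (TM2to1.trSupp M S)
  let _ : Inhabited {q // q ∈ T} := ⟨⟨default, hS0.1⟩⟩
  let g : PointedMap (TM1to0.Λ' (TM2to1.tr M)) {q // q ∈ T} :=
    ⟨fun q => if h : q ∈ T then ⟨q, h⟩ else default, by
      rw [dif_pos (show default ∈ T from hS0.1)]; rfl⟩
  let i : PointedMap (TM2to1.Γ' K Γ) (TM2to1.Γ' K Γ) := ⟨id, rfl⟩
  have hg : ∀ q ∈ (T : Set _), (g q : TM1to0.Λ' (TM2to1.tr M)) = q := fun q hq => by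
    change ((if h : q ∈ T then (⟨q, h⟩ : {q // q ∈ T}) else default) : {q // q ∈ T}).1 = q
    rw [dif_pos (show q ∈ T from hq)]
  refine ⟨{q // q ∈ T}, inferInstance, inferInstance, N.map i i g Subtype.val, fun k L => ?_⟩
  rw [← TM2to1.tr_eval_dom M k L, ← TM1to0.tr_eval]
  refine StateTransition.tr_eval_dom
    (TM0.Machine.map_respects N i i g Subtype.val hS0 (fun _ => rfl) hg) ⟨hS0.1, ?_⟩
  rw [TM0.map_init]
  exact congrArg TM0.init (List.map_id _)

/-- Binary increment, least significant digit first. -/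
def increment (l : List Bool) : List Bool :=
  List.recOn l [true] fun b t ih => bif b then false :: ih else true :: t

/-- Binary digits, least significant digit first. -/
def digits (n : ℕ) : List Bool :=
  Nat.rec [] (fun _ l => increment l) n

theorem primrec_increment : Primrec increment := by
  refine (Primrec.list_rec (f := id) (g := fun _ => [true])
    (h := fun (_ : List Bool) (x : Bool × List Bool × List Bool) =>
      bif x.1 then false :: x.2.2 else true :: x.2.1) Primrec.id (Primrec.const _) ?_).of_eq
    fun l => rfl
  exact (Primrec.cond (Primrec.fst.comp Primrec.snd)
    (Primrec.list_cons.comp (Primrec.const _)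
      (Primrec.snd.comp (Primrec.snd.comp Primrec.snd)))
    (Primrec.list_cons.comp (Primrec.const _)
      (Primrec.fst.comp (Primrec.snd.comp Primrec.snd)))).to₂

theorem primrec_digits : Primrec digits :=
  (Primrec.nat_rec₁ (f := fun _ l => increment l) [] (primrec_increment.comp Primrec.snd).to₂)

open PartrecToTM2 in
theorem map_increment_trPosNum (p : PosNum) {l : List Bool}
    (h : trPosNum p = l.map fun b => bif b then Γ'.bit1 else Γ'.bit0) :
    trPosNum p.succ = (increment l).map fun b => bif b then Γ'.bit1 else Γ'.bit0 := by
  induction p generalizing l with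
  | one =>
    match l, h with
    | [true], _ => rfl
  | bit0 p ih =>
    match l, h with
    | false :: l, h => exact congrArg (Γ'.bit1 :: ·) (List.cons.inj h).2
  | bit1 p ih =>
    match l, h with
    | true :: l, h => exact congrArg (Γ'.bit0 :: ·) (ih (List.cons.inj h).2)

-- Iterated increment exhibits the binary expansion as a primitive recursive function.
open PartrecToTM2 in
theorem trNat_eq_map_digits (n : ℕ) :
    trNat n = (digits n).map fun b => bif b then Γ'.bit1 else Γ'.bit0 := by
  induction n with
  | zero => rw [trNat_zero]; rfl
  | succ n ih =>
    rw [trNat, Nat.cast_succ, Num.add_one]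
    rw [trNat] at ih
    change _ = (increment (digits n)).map _
    cases h : (n : Num) with
    | zero =>
      rw [h] at ih
      rw [List.map_eq_nil_iff.1 ih.symm]
      rfl
    | pos p =>
      rw [h] at ih
      exact map_increment_trPosNum p ih

-- The tape alphabet carries no coding, so computability is stated after renaming its symbols by
-- numbers; each renaming is a finite table.
open PartrecToTM2 in
theorem computable_map_trInit (f : TM2to1.Γ' K' (fun _ => Γ') → ℕ) :
    Computable fun n : ℕ => (TM2to1.trInit (Γ := fun _ => Γ') K'.main (trList [n])).map f := by
  let g (a : Γ') : TM2to1.Γ' K' (fun _ => Γ') :=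
    (false, Function.update (fun _ => none) K'.main (some a))
  have h : Computable fun n : ℕ => f (true, (g Γ'.cons).2) ::
      (digits n).reverse.map fun b => f (g (bif b then Γ'.bit1 else Γ'.bit0)) := by
    refine Primrec.to_comp (Primrec.list_cons.comp (Primrec.const _) ?_)
    exact Primrec.list_map (Primrec.list_reverse.comp primrec_digits)
      ((Primrec.dom_finite fun b => f (g (bif b then Γ'.bit1 else Γ'.bit0))).comp Primrec.snd).to₂
  refine h.of_eq fun n => ?_
  have hl : (trList [n]).reverse =
      Γ'.cons :: (digits n).reverse.map fun b => bif b then Γ'.bit1 else Γ'.bit0 := by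
    simp [trList, trNat_eq_map_digits]
  rw [TM2to1.trInit, hl]
  change _ = f (true, (g Γ'.cons).2) :: List.map f (List.map g _)
  rw [List.map_map, List.map_map]
  rfl

/-- There is a Turing machine with an undecidable halting problem. -/
theorem exists_undecidable_machine :
    ∃ (Γ Λ : Type) (_ : Inhabited Γ) (_ : Inhabited Λ) (_ : Fintype Γ) (_ : Fintype Λ)
      (M : TM0.Machine Γ Λ) (input : ℕ → List Γ), (∀ n, input n ≠ []) ∧
        (∀ f : Γ → ℕ, Computable fun n => (input n).map f) ∧
        ¬ ComputablePred fun n => (TM0.eval M (input n)).Dom := by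
  have hK : Finite PartrecToTM2.K' :=
    Finite.of_injective (β := Fin 4) (fun k => PartrecToTM2.K'.casesOn k 0 1 2 3) <| by
      rintro (_ | _ | _ | _) (_ | _ | _ | _) <;> simp
  -- The simulated function runs the program with number `n` on input `0`.
  have hpart : Partrec fun n => Nat.Partrec.Code.eval (Denumerable.ofNat Nat.Partrec.Code n) 0 :=
    Nat.Partrec.Code.eval_part.comp (Computable.ofNat _) (Computable.const 0)
  obtain ⟨c, hc⟩ := ToPartrec.Code.exists_code (Nat.Partrec'.part_iff₁.2 hpart)
  -- `TM2.eval` starts in the default state, which is therefore chosen to be the entry point of `c`.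
  let _ : Inhabited PartrecToTM2.Λ' := ⟨PartrecToTM2.trNormal c .halt⟩
  obtain ⟨Λ₀, i₁, i₂, M, hM⟩ := exists_finite_machine PartrecToTM2.tr _
    (PartrecToTM2.tr_supports c .halt)
  cases nonempty_fintype PartrecToTM2.K'
  refine ⟨_, Λ₀, inferInstance, i₁, inferInstance, i₂, M,
    fun n => TM2to1.trInit PartrecToTM2.K'.main (PartrecToTM2.trList [n]),
    fun n => by simp [TM2to1.trInit], computable_map_trInit, fun h => ?_⟩
  refine ComputablePred.halting_problem 0 ?_
  have hiff (n : ℕ) : (TM0.eval M (TM2to1.trInit PartrecToTM2.K'.main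
      (PartrecToTM2.trList [n]))).Dom ↔
      (Nat.Partrec.Code.eval (Denumerable.ofNat Nat.Partrec.Code n) 0).Dom := by
    rw [hM]
    have hinit : TM2.init PartrecToTM2.K'.main (PartrecToTM2.trList [n]) =
        PartrecToTM2.init c [n] := by
      simp only [TM2.init, PartrecToTM2.init]
      congr 1
      funext k
      cases k <;> rfl
    change (StateTransition.eval (TM2.step PartrecToTM2.tr) (TM2.init _ _)).Dom ↔ _
    rw [hinit, PartrecToTM2.tr_eval]
    have := hc ⟨[n], rfl⟩
    rw [show c.eval [n] = _ from this]
    rfl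
  obtain ⟨f, hf, hp⟩ := ComputablePred.computable_iff.1 h
  refine ComputablePred.computable_iff.2 ⟨fun d => f (Encodable.encode d),
    hf.comp Computable.encode, ?_⟩
  funext d
  rw [← congrFun hp (Encodable.encode d), hiff, Denumerable.ofNat_encode]

end TapeQueue

/-! ### Computability of the reduction and conclusion -/

namespace CopyAutomaton

variable {Q A : Type*} [Encodable Q] [Encodable A]

theorem computable_automaton (E : List (QueueEdge Q A)) (B : List A) (p pf : Q) :
    Computable (automaton E B p pf) := by
  have h : Primrec fun z : List ℕ => (PDA.equivProd MarkedLetter ℕ ℕ).symm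
      (0, 0, [4], (PDATransition.equivProd MarkedLetter ℕ ℕ).symm
        (0, none, 0, Encodable.encode p + 5, z ++ [0]) :: coreTransitions E B pf) := by
    refine (Primrec.of_equiv_symm (e := PDA.equivProd MarkedLetter ℕ ℕ)).comp ?_
    refine Primrec.pair (.const _) (Primrec.pair (.const _) (Primrec.pair (.const _) ?_))
    refine Primrec.list_cons.comp ?_ (.const _)
    refine (Primrec.of_equiv_symm (e := PDATransition.equivProd MarkedLetter ℕ ℕ)).comp ?_
    exact Primrec.pair (.const _) (Primrec.pair (.const _) (Primrec.pair (.const _)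
      (Primrec.pair (.const _) (Primrec.list_append.comp .id (.const _)))))
  exact h.to_comp

end CopyAutomaton

open CopyAutomaton TapeQueue in
theorem theorem4p3 :
    ¬ DecidableOn {M : PDA MarkedLetter ℕ ℕ | M.IsDeterministic ∧ M.IsLinear}
      (fun M => ∃ w : List ℕ, unmarkedWord w ++ markedCopy w ∈ M.language) := by
  rintro ⟨f, hf, hdec⟩
  obtain ⟨Γ, Λ, _, _, _, _, M, input, hne, hcomp, hundec⟩ := exists_undecidable_machine
  let _ : Encodable (State Λ) := (nonempty_encodable _).some
  let _ : Encodable (Letter Γ) := (nonempty_encodable _).some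
  let _ : Fintype (Letter Γ) := Fintype.ofFinite _
  refine hundec ?_
  let start (n : ℕ) : List ℕ := ((inputQueue (input n)).map symbol).reverse
  have hstart : Computable start := by
    have h : Computable fun n => (symbol (Letter.sep : Letter Γ) ::
        ((input n).map fun a => symbol (Letter.head a)).headI ::
        ((input n).map fun a => symbol (Letter.plain a)).tail).reverse :=
      Primrec.list_reverse.to_comp.comp (Primrec.list_cons.to_comp.comp (.const _)
        (Primrec.list_cons.to_comp.comp (Primrec.list_headI.to_comp.comp (hcomp _))
          (Primrec.list_tail.to_comp.comp (hcomp _))))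
    refine h.of_eq fun n => ?_
    -- On an empty input, `headI` after the renaming would give `0`, not the symbol of a blank under
    -- the head.
    obtain ⟨a, l, hl⟩ := List.exists_cons_of_ne_nil (hne n)
    simp [start, inputQueue, hl, Function.comp_def]
  let N (n : ℕ) := automaton (edges M) (Finset.univ : Finset (Letter Γ)).toList
    (State.scan default) State.halt (start n)
  have hN (n : ℕ) := hdec (N n) ⟨isDeterministic, isLinear⟩
  have hiff (n : ℕ) : (∃ w, unmarkedWord w ++ markedCopy w ∈ (N n).language) ↔
      (Turing.TM0.eval M (input n)).Dom :=
    (exists_mem_language_iff (fun a => Finset.mem_toList.2 (Finset.mem_univ a)) _).trans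
      (accepts_iff M (input n))
  choose b hb hbiff using hN
  -- The assumed algorithm `f` may diverge elsewhere, but every `N n` is in the class, so its
  -- composition with the reduction is total.
  have hbcomp : Computable b :=
    (hf.comp ((computable_automaton _ _ _ _).comp hstart)).of_eq fun n => Part.eq_some_iff.2 (hb n)
  exact ComputablePred.computable_iff.2 ⟨b, hbcomp, funext fun n =>
    propext ((hiff n).symm.trans (hbiff n).symm)⟩
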